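/- Let $n\ge 1$ be an integer. For a sub-semigroup $G$ of the multiplicative semigroup $M_n(\mathbb{R})$ of real $n\times n$ matrices and $v\in\mathbb{R}^n$, let $G(v)=\{Av : A\in G\}$; $G$ is called hypercyclic if there is a vector $v\in\mathbb{R}^n$ such that $G(v)$ is dense in $\mathbb{R}^n$. Then the minimum number $p$ of matrices $A_1,\dots,A_p\in M_n(\mathbb{R})$ such that the semigroup generated by $A_1,\dots,A_p$ is abelian and hypercyclic is exactly $\left[\frac{n+1}{2}\right]+1$, where $[\,\cdot\,]$ denotes the integer part. That is, there exist $\left[\frac{n+1}{2}\right]+1$ matrices in $M_n(\mathbb{R})$ that generate a hypercyclic abelian semigroup, and no abelian semigroup generated by fewer matrices of $M_n(\mathbb{R})$ is hypercyclic. -/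

import Mathlib

namespace MatrixSemigroup

/-- The orbit `G(v) = {A v : A ∈ G}` of a vector `v ∈ ℝⁿ` under a sub-semigroup `G` of `Mₙ(ℝ)`. -/
def orbit {n : ℕ} (G : Subsemigroup (Matrix (Fin n) (Fin n) ℝ)) (v : Fin n → ℝ) :
    Set (Fin n → ℝ) :=
  {w | ∃ A ∈ G, A.mulVec v = w}

/-- `G` is hypercyclic if some vector has a dense orbit in `ℝⁿ` (`Fin n → ℝ` with the product
topology, which is the usual topology of `ℝⁿ`). -/
def IsHypercyclic {n : ℕ} (G : Subsemigroup (Matrix (Fin n) (Fin n) ℝ)) : Prop :=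
  ∃ v : Fin n → ℝ, Dense (orbit G v)

/-- `G` is abelian: any two of its elements commute. -/
def IsAbelian {n : ℕ} (G : Subsemigroup (Matrix (Fin n) (Fin n) ℝ)) : Prop :=
  ∀ A ∈ G, ∀ B ∈ G, A * B = B * A

/-- The sub-semigroup of `Mₙ(ℝ)` generated by the matrices `A₁, …, Aₚ`. -/
def generatedBy {n p : ℕ} (A : Fin p → Matrix (Fin n) (Fin n) ℝ) :
    Subsemigroup (Matrix (Fin n) (Fin n) ℝ) :=
  Subsemigroup.closure (Set.range A)

end MatrixSemigroup

/-! Lower bound: if commuting operators have a dense orbit at `v`, evaluation at `v` identifies the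
algebra they generate with `ℝⁿ`, so `p` elements of an `n`-dimensional commutative algebra generate
a dense multiplicative semigroup. Pull the group spanned by the invertible generators back along the
open homomorphism `exp`: the result is a dense additive subgroup, contained in one with at most `p +
r` generators. Here `r ≤ n / 2` bounds the generators needed for `ker exp`, at most one per pair of
nonreal conjugate characters. Density needs more than `n` generators, so `n + 2 ≤ 2 * p`.

Upper bound: in a product of copies of `ℂ`, with one `ℝ` if `n` is odd, take `-e` in each factor and
one generic element `a`. For `0 < |x| < 1` and large `k`, a power of `-e` brings `w / x ^ k` to
bounded size, and a `k`-th root of the result is near 1. So `x` can be perturbed to hit `w`, and a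
Baire argument then supplies `a`. -/

open Module Filter Topology

namespace MatrixSemigroup

/-! ### Finitely generated subgroups -/

/-- A subset of a finite-dimensional real space contained in the `ℤ`-span of finitely many vectors
can only be dense if there are more vectors than the dimension. -/
theorem finrank_lt_card_of_dense_span_int {E ι : Type*} [NormedAddCommGroup E] [NormedSpace ℝ E]
    [FiniteDimensional ℝ E] [Nontrivial E] [Fintype ι] (b : ι → E)
    (h : Dense (Submodule.span ℤ (Set.range b) : Set E)) : finrank ℝ E < Fintype.card ι := by
  have hsub : (Submodule.span ℤ (Set.range b) : Set E) ⊆ Submodule.span ℝ (Set.range b) :=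
    Submodule.span_subset_span ℤ ℝ _
  have htop : Submodule.span ℝ (Set.range b) = ⊤ := by
    have hc : IsClosed (Submodule.span ℝ (Set.range b) : Set E) :=
      Submodule.closed_of_finiteDimensional _
    have := (h.mono hsub).closure_eq
    rw [hc.closure_eq] at this
    exact SetLike.coe_injective (by simpa using this)
  by_contra! hcard
  have hge : finrank ℝ E ≤ Fintype.card ι := by
    have := finrank_range_le_card (R := ℝ) b
    rwa [Set.finrank, htop, finrank_top] at this
  let B := basisOfTopLeSpanOfCardEqFinrank b htop.ge (le_antisymm hcard hge)
  have hB : ∀ i, B i = b i := fun i => by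
    simp [B]
  have : Nonempty ι := B.index_nonempty
  obtain ⟨i⟩ := this
  have hcont : Continuous (B.coord i) := LinearMap.continuous_of_finiteDimensional _
  have hclosed : IsClosed {x : E | B.coord i x ∈ Set.range ((↑) : ℤ → ℝ)} :=
    Int.isClosedEmbedding_coe_real.isClosed_range.preimage hcont
  have hall : (Submodule.span ℤ (Set.range b) : Set E) ⊆
      {x : E | B.coord i x ∈ Set.range ((↑) : ℤ → ℝ)} := by
    intro x hx
    induction hx using Submodule.span_induction with
    | mem x hx =>
      obtain ⟨j, rfl⟩ := hx
      rw [← hB]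
      by_cases hij : j = i
      · exact ⟨1, by simp [hij]⟩
      · exact ⟨0, by simp [hij]⟩
    | zero => exact ⟨0, by simp⟩
    | add x y _ _ hx hy =>
      obtain ⟨k, hk⟩ := hx
      obtain ⟨l, hl⟩ := hy
      exact ⟨k + l, by rw [map_add, ← hk, ← hl]; push_cast; rfl⟩
    | smul c x _ hx =>
      obtain ⟨k, hk⟩ := hx
      exact ⟨c * k, by rw [map_zsmul, ← hk]; simp⟩
  -- Half a basis vector has a non-integral coordinate.
  have hmem : (2⁻¹ : ℝ) • B i ∈ {x : E | B.coord i x ∈ Set.range ((↑) : ℤ → ℝ)} := by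
    have := (h.mono hall).closure_eq
    rw [hclosed.closure_eq] at this
    rw [this]
    trivial
  obtain ⟨k, hk⟩ := hmem
  have hk' : (k : ℝ) * 2 = 1 := by
    rw [hk]
    simp
  have : k * 2 = 1 := by exact_mod_cast hk'
  omega

/-- A subgroup that embeds in `ℤ^κ` is generated by at most `|κ|` elements. -/
theorem exists_span_eq_of_injective {M κ : Type*} [AddCommGroup M] [Fintype κ] (Γ : Submodule ℤ M)
    (ψ : Γ →ₗ[ℤ] (κ → ℤ)) (hψ : Function.Injective ψ) :
    ∃ q ≤ Fintype.card κ, ∃ b : Fin q → M, Γ = Submodule.span ℤ (Set.range b) := by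
  let e := LinearEquiv.ofInjective ψ hψ
  let B := (finBasis ℤ (LinearMap.range ψ)).map e.symm
  refine ⟨_, ?_, fun i => (B i : M), ?_⟩
  · simpa using Submodule.finrank_le (LinearMap.range ψ)
  · have : Set.range (fun i => (B i : M)) = Γ.subtype '' Set.range B := by
      rw [← Set.range_comp]; rfl
    rw [this, Submodule.span_image, B.span_eq]
    simp

/-- The preimage of a subgroup with `p` generators under a homomorphism whose kernel has `r`
generators is contained in a subgroup with at most `r + p` generators. -/
theorem comap_span_le {M N : Type*} [AddCommGroup M] [AddCommGroup N] (e : M →ₗ[ℤ] N) {r p : ℕ}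
    (c : Fin r → M) (hc : LinearMap.ker e = Submodule.span ℤ (Set.range c)) (u : Fin p → N) :
    ∃ q ≤ p, ∃ b : Fin r ⊕ Fin q → M,
      (Submodule.span ℤ (Set.range u)).comap e ≤ Submodule.span ℤ (Set.range b) := by
  let U := Fintype.linearCombination ℤ u
  -- The relevant combinations of `u` form a subgroup of `ℤ^p`, hence need at most `p` generators.
  let K : Submodule ℤ (Fin p → ℤ) := (LinearMap.range e).comap U
  obtain ⟨q, hq, k, hk⟩ := exists_span_eq_of_injective K K.subtype K.subtype_injective
  have hkK : ∀ j, ∃ a, e a = U (k j) := fun j => by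
    have : k j ∈ K := hk ▸ Submodule.subset_span ⟨j, rfl⟩
    exact this
  choose a ha using hkK
  refine ⟨q, by simpa using hq, Sum.elim c a, ?_⟩
  intro h hh
  rw [Submodule.mem_comap, Submodule.mem_span_range_iff_exists_fun] at hh
  obtain ⟨z, hz⟩ := hh
  have hzK : z ∈ K := ⟨h, by rw [← hz]; simp [U, Fintype.linearCombination_apply]⟩
  rw [hk, Submodule.mem_span_range_iff_exists_fun] at hzK
  obtain ⟨w, rfl⟩ := hzK
  have hker : h - ∑ j, w j • a j ∈ LinearMap.ker e := by
    have hU : U (∑ j, w j • k j) = e h := by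
      rw [← hz]
      simp only [U, Fintype.linearCombination_apply]
    rw [LinearMap.mem_ker, map_sub, map_sum, ← hU, map_sum, sub_eq_zero]
    simp only [map_smul, ha]
  rw [hc] at hker
  rw [Set.Sum.elim_range, Submodule.span_union]
  rw [← sub_add_cancel h (∑ j, w j • a j)]
  exact Submodule.add_mem_sup hker
    (Submodule.sum_mem _ fun j _ => Submodule.smul_mem _ _ (Submodule.subset_span ⟨j, rfl⟩))

/-! ### Nilpotents and the kernel of the exponential -/

/-- An element of a finite-dimensional commutative real algebra that is killed by all complex
characters is nilpotent. -/
theorem isNilpotent_of_forall_algHom_eq_zero {A : Type*} [CommRing A] [Algebra ℝ A]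
    [FiniteDimensional ℝ A] {a : A} (h : ∀ χ : A →ₐ[ℝ] ℂ, χ a = 0) : IsNilpotent a := by
  rw [← mem_nilradical, nilradical_eq_sInf, Submodule.mem_sInf]
  intro (P : Ideal A) (hP : P.IsPrime)
  have : IsArtinianRing A := IsArtinianRing.of_finite ℝ A
  have hmax : P.IsMaximal := inferInstance
  let _ := Ideal.Quotient.field P
  have : Algebra.IsAlgebraic ℝ (A ⧸ P) := inferInstance
  let χ : (A ⧸ P) →ₐ[ℝ] ℂ := IsAlgClosed.lift
  have := h (χ.comp (Ideal.Quotient.mkₐ ℝ P))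
  rw [AlgHom.comp_apply] at this
  exact Ideal.Quotient.eq_zero_iff_mem.mp ((map_eq_zero χ).mp this)

/-- If `k + 2` is the nilpotency index, multiplying the series by `a ^ k` leaves `a ^ k = a ^ k + a
^ (k + 1)`, against minimality. -/
theorem eq_zero_of_isNilpotent_of_exp_eq_one {A : Type*} [NormedRing A] [NormedAlgebra ℝ A]
    [CompleteSpace A] {a : A} (ha : IsNilpotent a) (h : NormedSpace.exp a = 1) : a = 0 := by
  classical
  by_contra hne
  have hk := Nat.find_spec ha
  have hmin := fun m => Nat.find_min (m := m) ha
  set k := Nat.find ha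
  match hkk : k with
  | 0 => rw [pow_zero] at hk; exact hne (by rw [← mul_one a, hk, mul_zero])
  | 1 => exact hne (by simpa using hk)
  | k + 2 =>
    have hs := (NormedSpace.exp_series_hasSum_exp' (𝕂 := ℝ) a).mul_left (a ^ k)
    have hs' := hasSum_sum_of_ne_finset_zero (L := .unconditional ℕ) (s := Finset.range 2)
      (f := fun n => a ^ k * ((n.factorial : ℝ)⁻¹ • a ^ n)) (by
        intro n hn
        have h2 : 2 ≤ n := by simpa [Nat.succ_le_iff] using hn
        obtain ⟨m, rfl⟩ := Nat.exists_eq_add_of_le h2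
        rw [mul_smul_comm, ← pow_add, ← add_assoc, pow_add, hk, zero_mul, smul_zero])
    have := hs.unique hs'
    rw [h] at this
    simp [Finset.sum_range_succ, ← pow_succ] at this
    exact hmin (k + 1) (by omega) this


section Exp

variable {A : Type*} [NormedCommRing A] [NormedAlgebra ℝ A] [FiniteDimensional ℝ A]

theorem exp_add_of_finiteDimensional (a b : A) :
    NormedSpace.exp (a + b) = NormedSpace.exp a * NormedSpace.exp b := by
  have : CompleteSpace A := FiniteDimensional.complete ℝ A
  let _ : NormedAlgebra ℚ A := NormedAlgebra.restrictScalars ℚ ℝ A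
  exact NormedSpace.exp_add

variable (A) in
/-- The exponential of a finite-dimensional commutative real algebra, as a homomorphism from its
additive group to its group of units. -/
noncomputable def expHom : A →ₗ[ℤ] Additive Aˣ :=
  AddMonoidHom.toIntLinearMap
    { toFun := fun a => Additive.ofMul
        ⟨NormedSpace.exp a, NormedSpace.exp (-a),
          by rw [← exp_add_of_finiteDimensional, add_neg_cancel, NormedSpace.exp_zero],
          by rw [← exp_add_of_finiteDimensional, neg_add_cancel, NormedSpace.exp_zero]⟩
      map_zero' := by
        rw [← ofMul_one]
        congr 1
        exact Units.ext NormedSpace.exp_zero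
      map_add' := fun a b => by
        rw [← ofMul_mul]
        congr 1
        exact Units.ext (exp_add_of_finiteDimensional a b) }

theorem coe_expHom (a : A) : ((expHom A a).toMul : A) = NormedSpace.exp a := rfl

theorem mem_ker_expHom (a : A) : a ∈ LinearMap.ker (expHom A) ↔ NormedSpace.exp a = 1 := by
  rw [LinearMap.mem_ker, ← coe_expHom, Units.val_eq_one, toMul_eq_one]

theorem exists_int_of_exp_eq_one {a : A} (ha : NormedSpace.exp a = 1) (χ : A →ₐ[ℝ] ℂ) :
    ∃ k : ℤ, χ a = k * (2 * Real.pi * Complex.I) := by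
  have : CompleteSpace A := FiniteDimensional.complete ℝ A
  let _ : NormedAlgebra ℚ A := NormedAlgebra.restrictScalars ℚ ℝ A
  have hc : Continuous χ := χ.toLinearMap.continuous_of_finiteDimensional
  have := NormedSpace.map_exp χ hc a
  rw [ha, map_one, ← Complex.exp_eq_exp_ℂ] at this
  exact Complex.exp_eq_one_iff.mp this.symm

/-- The kernel of the exponential of a commutative real algebra of dimension `n` is generated by
at most `n / 2` elements. -/
theorem exists_ker_expHom_eq_span :
    ∃ r, 2 * r ≤ finrank ℝ A ∧
      ∃ c : Fin r → A, LinearMap.ker (expHom A) = Submodule.span ℤ (Set.range c) := by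
  classical
  have : CompleteSpace A := FiniteDimensional.complete ℝ A
  have : Finite (A →ₐ[ℝ] ℂ) := inferInstance
  let _ : Fintype (A →ₐ[ℝ] ℂ) := Fintype.ofFinite _
  let σ : (A →ₐ[ℝ] ℂ) → (A →ₐ[ℝ] ℂ) := fun χ => (Complex.conjAe : ℂ →ₐ[ℝ] ℂ).comp χ
  have hσa : ∀ χ a, σ χ a = starRingEnd ℂ (χ a) := fun χ a => rfl
  have hσσ : ∀ χ, σ (σ χ) = χ := fun χ => by
    ext a
    simp [hσa]
  -- The well-order selects one character from each nonreal conjugate pair.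
  let κ := {χ : A →ₐ[ℝ] ℂ // WellOrderingRel χ (σ χ)}
  have hκ : 2 * Fintype.card κ ≤ finrank ℝ A := by
    let f : κ ⊕ κ → (A →ₐ[ℝ] ℂ) := Sum.elim (fun χ => χ.1) (fun χ => σ χ.1)
    have hf : Function.Injective f := by
      have hne : ∀ χ ψ : κ, χ.1 ≠ σ ψ.1 := fun χ ψ h => by
        have h1 := χ.2
        rw [h, hσσ] at h1
        exact asymm_of WellOrderingRel h1 ψ.2
      rintro (χ | χ) (ψ | ψ) h
      · exact congrArg Sum.inl (Subtype.ext h)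
      · exact absurd h (hne χ ψ)
      · exact absurd h.symm (hne ψ χ)
      · refine congrArg Sum.inr (Subtype.ext ?_)
        have := congrArg σ (show σ χ.1 = σ ψ.1 from h)
        rwa [hσσ, hσσ] at this
    have h1 := Fintype.card_le_of_injective f hf
    have h2 := card_algHom_le_finrank ℝ A ℂ
    rw [Nat.card_eq_fintype_card] at h2
    rw [Fintype.card_sum] at h1
    omega
  have hk : ∀ (a : LinearMap.ker (expHom A)) (χ : A →ₐ[ℝ] ℂ),
      ∃ k : ℤ, χ a = k * (2 * Real.pi * Complex.I) := fun a χ =>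
    exists_int_of_exp_eq_one ((mem_ker_expHom _).mp a.2) χ
  choose k hk using hk
  have h2πI : (2 * Real.pi * Complex.I : ℂ) ≠ 0 := Complex.two_pi_I_ne_zero
  let ψ : LinearMap.ker (expHom A) →ₗ[ℤ] (κ → ℤ) := AddMonoidHom.toIntLinearMap
    (AddMonoidHom.mk' (fun a χ => k a χ.1) (fun a b => by
      ext χ
      have h := hk (a + b) χ.1
      rw [Submodule.coe_add, map_add, hk, hk, ← add_mul] at h
      exact_mod_cast (mul_right_cancel₀ h2πI h).symm))
  have hψ : Function.Injective ψ := by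
    rw [injective_iff_map_eq_zero]
    intro a ha
    have hpos : ∀ χ : A →ₐ[ℝ] ℂ, WellOrderingRel χ (σ χ) → χ a = 0 := fun χ hχ => by
      have : k a χ = 0 := congrFun ha ⟨χ, hχ⟩
      rw [hk, this, Int.cast_zero, zero_mul]
    have hall : ∀ χ : A →ₐ[ℝ] ℂ, χ a = 0 := fun χ => by
      rcases trichotomous_of WellOrderingRel χ (σ χ) with h | h | h
      · exact hpos χ h
      -- A self-conjugate character takes a real value, which also lies in `2πiℤ`, so it vanishes.
      · have h1 : starRingEnd ℂ (χ a) = χ a := by rw [← hσa, ← h]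
        rw [hk] at h1 ⊢
        simp only [map_mul, map_intCast, Complex.conj_I, Complex.conj_ofReal, map_ofNat] at h1
        have h3 : (k a χ : ℂ) * (2 * Real.pi * Complex.I) = 0 := by linear_combination -h1 / 2
        exact h3
      · have h1 := hpos (σ χ) (by rwa [hσσ])
        rw [hσa] at h1
        simpa using h1
    exact Subtype.ext (eq_zero_of_isNilpotent_of_exp_eq_one
      (isNilpotent_of_forall_algHom_eq_zero hall) ((mem_ker_expHom _).mp a.2))
  obtain ⟨r, hr, c, hc⟩ := exists_span_eq_of_injective _ ψ hψ
  exact ⟨r, by omega, c, hc⟩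

/-- If the multiplicative semigroup generated by `p` elements of a commutative real algebra of
dimension `n` is dense, then `n + 2 ≤ 2 * p`. -/
theorem finrank_add_two_le_of_dense_closure [Nontrivial A] {p : ℕ} (g : Fin p → A)
    (h : Dense (Subsemigroup.closure (Set.range g) : Set A)) : finrank ℝ A + 2 ≤ 2 * p := by
  classical
  have : CompleteSpace A := FiniteDimensional.complete ℝ A
  -- The value at non-units is harmless: they divide no invertible product.
  let u : Fin p → Additive Aˣ := fun i =>
    if hi : IsUnit (g i) then Additive.ofMul hi.unit else 0
  have hu : ∀ s ∈ Subsemigroup.closure (Set.range g), IsUnit s →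
      ∃ q ∈ Submodule.span ℤ (Set.range u), (q.toMul : A) = s := by
    intro s hs
    induction hs using Subsemigroup.closure_induction with
    | mem x hx =>
      obtain ⟨i, rfl⟩ := hx
      intro hi
      exact ⟨u i, Submodule.subset_span ⟨i, rfl⟩, by simp [u, hi]⟩
    | mul x y _ _ hx hy =>
      intro hxy
      obtain ⟨q, hq, rfl⟩ := hx (isUnit_of_mul_isUnit_left hxy)
      obtain ⟨q', hq', rfl⟩ := hy (isUnit_of_mul_isUnit_right hxy)
      exact ⟨q + q', add_mem hq hq', by simp⟩
  obtain ⟨r, hr, c, hc⟩ := exists_ker_expHom_eq_span (A := A)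
  obtain ⟨q, hq, b, hb⟩ := comap_span_le (expHom A) c hc u
  have hopen : IsOpenMap (NormedSpace.exp : A → A) := by
    rw [isOpenMap_iff_nhds_le]
    intro a
    refine ((hasStrictFDerivAt_exp (𝕂 := ℝ) (x := a)).map_nhds_eq_of_surj ?_).ge
    rw [LinearMap.range_eq_top]
    intro y
    refine ⟨NormedSpace.exp (-a) * y, ?_⟩
    simp [← mul_assoc, ← exp_add_of_finiteDimensional]
  have hdense : Dense ((Submodule.span ℤ (Set.range u)).comap (expHom A) : Set A) := by
    rw [dense_iff_inter_open]
    rintro U hU ⟨x, hx⟩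
    obtain ⟨_, ⟨a, ha, rfl⟩, hs⟩ := h.inter_open_nonempty _ (hopen U hU) ⟨_, x, hx, rfl⟩
    obtain ⟨q, hq, hqa⟩ := hu _ hs (expHom A a).toMul.isUnit
    refine ⟨a, ha, ?_⟩
    have : expHom A a = q := by
      apply Additive.toMul.injective
      exact Units.ext hqa.symm
    simpa [this] using hq
  have := finrank_lt_card_of_dense_span_int b (hdense.mono hb)
  simp at this
  omega

end Exp

/-! ### From operators to the algebra they generate -/

/-- A commuting tuple of `p` operators whose generated semigroup has a dense orbit in a space of
dimension `n ≥ 1` satisfies `n + 2 ≤ 2 * p`. -/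
theorem finrank_add_two_le_of_dense_orbit {E : Type*} [NormedAddCommGroup E] [NormedSpace ℝ E]
    [FiniteDimensional ℝ E] [Nontrivial E] {p : ℕ} (T : Fin p → E →L[ℝ] E)
    (hT : ∀ i j, T i * T j = T j * T i) (v : E)
    (h : Dense ((fun S : E →L[ℝ] E => S v) '' (Subsemigroup.closure (Set.range T) : Set _))) :
    finrank ℝ E + 2 ≤ 2 * p := by
  let 𝒜 := Algebra.adjoin ℝ (Set.range T)
  have hcomm : ∀ x ∈ Set.range T, ∀ y ∈ Set.range T, x * y = y * x := by
    rintro _ ⟨i, rfl⟩ _ ⟨j, rfl⟩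
    exact hT i j
  have hmul : ∀ x y : 𝒜, x * y = y * x :=
    (Algebra.isMulCommutative_adjoin ℝ hcomm).is_comm.comm
  let _ : NormedCommRing 𝒜 := { (inferInstance : NormedRing 𝒜) with mul_comm := hmul }
  let g : Fin p → 𝒜 := fun i => ⟨T i, Algebra.subset_adjoin ⟨i, rfl⟩⟩
  let ev : 𝒜 →ₗ[ℝ] E :=
    { toFun := fun a => (a : E →L[ℝ] E) v
      map_add' := fun _ _ => rfl
      map_smul' := fun _ _ => rfl }
  have hg : ∀ S ∈ Subsemigroup.closure (Set.range T),
      ∃ s ∈ Subsemigroup.closure (Set.range g), (s : E →L[ℝ] E) = S := by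
    intro S hS
    induction hS using Subsemigroup.closure_induction with
    | mem x hx =>
      obtain ⟨i, rfl⟩ := hx
      exact ⟨g i, Subsemigroup.subset_closure ⟨i, rfl⟩, rfl⟩
    | mul x y _ _ hx hy =>
      obtain ⟨s, hs, rfl⟩ := hx
      obtain ⟨t, ht, rfl⟩ := hy
      exact ⟨s * t, mul_mem hs ht, rfl⟩
  have hsub : (fun S : E →L[ℝ] E => S v) '' (Subsemigroup.closure (Set.range T) : Set _) ⊆
      ev '' (Subsemigroup.closure (Set.range g) : Set 𝒜) := by
    rintro _ ⟨S, hS, rfl⟩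
    obtain ⟨s, hs, rfl⟩ := hg S hS
    exact ⟨s, hs, rfl⟩
  have hdense := h.mono hsub
  have hsurj : Function.Surjective ev := by
    have hc : IsClosed (LinearMap.range ev : Set E) := Submodule.closed_of_finiteDimensional _
    have hd : Dense (LinearMap.range ev : Set E) := hdense.mono (by
      rintro _ ⟨s, _, rfl⟩
      exact ⟨s, rfl⟩)
    have := hd.closure_eq
    rw [hc.closure_eq] at this
    intro x
    have : x ∈ (LinearMap.range ev : Set E) := this ▸ trivial
    exact this
  -- If `a v = 0` then `a (b v) = b (a v) = 0`, and the vectors `b v` fill `E`.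
  have hinj : Function.Injective ev := by
    rw [injective_iff_map_eq_zero]
    intro a ha
    refine Subtype.ext (ContinuousLinearMap.ext fun x => ?_)
    obtain ⟨b, rfl⟩ := hsurj x
    have : ((a * b : 𝒜) : E →L[ℝ] E) v = ((b * a : 𝒜) : E →L[ℝ] E) v := by rw [hmul]
    have h2 : (a : E →L[ℝ] E) v = 0 := ha
    have h3 : (a : E →L[ℝ] E) ((b : E →L[ℝ] E) v) = 0 := by simpa [h2] using this
    exact h3
  let e : 𝒜 ≃ₗ[ℝ] E := LinearEquiv.ofBijective ev ⟨hinj, hsurj⟩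
  have : FiniteDimensional ℝ 𝒜 := e.symm.finiteDimensional
  have : Nontrivial 𝒜 := e.toEquiv.nontrivial
  let e' := e.toContinuousLinearEquiv
  have hd : Dense (Subsemigroup.closure (Set.range g) : Set 𝒜) := by
    have := e'.toHomeomorph.isInducing.dense_iff (s := (Subsemigroup.closure (Set.range g) : Set 𝒜))
    rw [this]
    intro x
    exact hdense _
  rw [← e.finrank_eq]
  exact finrank_add_two_le_of_dense_closure g hd

theorem add_two_le_of_isHypercyclic {n p : ℕ} (hn : 1 ≤ n) (A : Fin p → Matrix (Fin n) (Fin n) ℝ)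
    (hab : IsAbelian (generatedBy A)) (hhc : IsHypercyclic (generatedBy A)) :
    n + 2 ≤ 2 * p := by
  obtain ⟨v, hv⟩ := hhc
  have : Nonempty (Fin n) := ⟨⟨0, hn⟩⟩
  let Φ : Matrix (Fin n) (Fin n) ℝ → ((Fin n → ℝ) →L[ℝ] (Fin n → ℝ)) := fun M =>
    LinearMap.toContinuousLinearMap (Matrix.toLin' M)
  have hΦ : ∀ M w, Φ M w = M.mulVec w := fun M w => rfl
  have hΦmul : ∀ M N, Φ (M * N) = Φ M * Φ N := fun M N => by
    ext1 w
    simp [hΦ]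
  have key := finrank_add_two_le_of_dense_orbit (fun i => Φ (A i))
    (fun i j => by
      rw [← hΦmul, ← hΦmul, hab _ (Subsemigroup.subset_closure ⟨i, rfl⟩) _
        (Subsemigroup.subset_closure ⟨j, rfl⟩)]) v (hv.mono ?_)
  · simpa using key
  · rintro _ ⟨M, hM, rfl⟩
    refine ⟨Φ M, ?_, rfl⟩
    induction hM using Subsemigroup.closure_induction with
    | mem x hx =>
      obtain ⟨i, rfl⟩ := hx
      exact Subsemigroup.subset_closure ⟨i, rfl⟩
    | mul x y _ _ hx hy =>
      rw [hΦmul]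
      exact mul_mem hx hy


/-! ### Dense semigroups in products of `ℝ` and `ℂ` -/

/-- Birkhoff transitivity for a family of maps between two different spaces, localised to an open
set. -/
theorem exists_dense_range_of_transitive {X Y ι : Type*} [TopologicalSpace X] [BaireSpace X]
    [TopologicalSpace Y] [SecondCountableTopology Y] (F : ι → X → Y) (hF : ∀ i, Continuous (F i))
    {W : Set X} (hW : IsOpen W) (hne : W.Nonempty)
    (H : ∀ V ⊆ W, IsOpen V → V.Nonempty → ∀ U, IsOpen U → U.Nonempty → ∃ i, ∃ x ∈ V, F i x ∈ U) :
    ∃ x ∈ W, Dense (Set.range fun i => F i x) := by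
  let 𝓑 := TopologicalSpace.countableBasis Y
  have : Countable 𝓑 := (TopologicalSpace.countable_countableBasis Y).to_subtype
  -- Adjoining the exterior of `W` makes these sets dense in all of `X`.
  let O : 𝓑 → Set X := fun U => (⋃ i, F i ⁻¹' U) ∪ (closure W)ᶜ
  have hO : ∀ U, IsOpen (O U) := fun U =>
    (isOpen_iUnion fun i =>
      (TopologicalSpace.isOpen_of_mem_countableBasis U.2).preimage (hF i)).union
      isClosed_closure.isOpen_compl
  have hd : ∀ U, Dense (O U) := by
    intro U
    rw [dense_iff_inter_open]
    intro V hV hVne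
    by_cases hVW : (V ∩ W).Nonempty
    · obtain ⟨i, x, hx, hxU⟩ := H (V ∩ W) Set.inter_subset_right (hV.inter hW) hVW U
        (TopologicalSpace.isOpen_of_mem_countableBasis U.2)
        (TopologicalSpace.nonempty_of_mem_countableBasis U.2)
      exact ⟨x, hx.1, Or.inl (Set.mem_iUnion.mpr ⟨i, hxU⟩)⟩
    · obtain ⟨x, hx⟩ := hVne
      refine ⟨x, hx, Or.inr fun hxc => hVW ?_⟩
      exact mem_closure_iff.mp hxc V hV hx
  obtain ⟨x, hxW, hx⟩ := (dense_iInter_of_isOpen hO hd).inter_open_nonempty W hW hne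
  refine ⟨x, hxW, ?_⟩
  rw [(TopologicalSpace.isBasis_countableBasis Y).dense_iff]
  intro U hU _
  rcases Set.mem_iInter.mp hx ⟨U, hU⟩ with h | h
  · obtain ⟨i, hi⟩ := Set.mem_iUnion.mp h
    exact ⟨_, hi, i, rfl⟩
  · exact absurd (subset_closure hxW) h

section Block

variable {K : Subalgebra ℝ ℂ}

theorem exp_mem_of_eq_top_or_bot (hK : K = ⊤ ∨ K = ⊥) {z : ℂ} (hz : z ∈ K) :
    Complex.exp z ∈ K := by
  rcases hK with rfl | rfl
  · trivial
  · obtain ⟨x, rfl⟩ := hz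
    exact ⟨Real.exp x, by simp⟩

theorem exists_log_mem_of_eq_top_or_bot (hK : K = ⊤ ∨ K = ⊥) {z : ℂ} (hz : z ∈ K) :
    ∃ ε : ℕ, ε ≤ 1 ∧ Complex.log ((-1) ^ ε * z) ∈ K := by
  rcases hK with rfl | rfl
  · exact ⟨0, zero_le_one, trivial⟩
  · obtain ⟨x, rfl⟩ := hz
    rcases le_total 0 x with hx | hx
    · exact ⟨0, zero_le_one, Real.log x, by simp [Complex.ofReal_log hx]⟩
    · refine ⟨1, le_rfl, Real.log (-x), ?_⟩
      have := Complex.ofReal_log (neg_nonneg.mpr hx)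
      simpa using this

/-- The scalar `-e`, seen in a real subalgebra of `ℂ`. -/
noncomputable def negExpOne (K : Subalgebra ℝ ℂ) : K := algebraMap ℝ K (-Real.exp 1)

theorem coe_negExpOne : (negExpOne K : ℂ) = -Complex.exp 1 := by
  simp [negExpOne]

/-- The parity is prescribed so that `(-1) ^ m` cancels the sign needed to take a real logarithm. -/
theorem exists_nat_parity_near {ε : ℕ} (hε : ε ≤ 1) {t : ℝ} (ht : 1 ≤ t) :
    ∃ l : ℕ, |t - ((2 * l + ε : ℕ) : ℝ)| ≤ 2 := by
  have hε' : (ε : ℝ) ≤ 1 := by exact_mod_cast hε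
  refine ⟨⌊(t - ε) / 2⌋₊, ?_⟩
  have h1 := Nat.floor_le (show 0 ≤ (t - ε) / 2 by linarith)
  have h2 := Nat.lt_floor_add_one ((t - ε) / 2)
  rw [abs_le]
  push_cast
  constructor <;> linarith

/-- Take `x = a * exp ((L - m) / k)` with `L = log (± w / a ^ k)`. As `|a| < 1`, `Re L → ∞`, so some
natural `m` of the right parity keeps `L - m` bounded by `2 + 4`, and `x → a`. -/
theorem eventually_exists_pow_mul_pow_eq (hK : K = ⊤ ∨ K = ⊥) {a w : K} (ha : a ≠ 0)
    (ha1 : ‖(a : ℂ)‖ < 1) (hw : w ≠ 0) {V : Set K} (hV : V ∈ 𝓝 a) :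
    ∀ᶠ k : ℕ in atTop, ∃ x ∈ V, ∃ m : ℕ, negExpOne K ^ m * x ^ k = w := by
  have ha0 : (a : ℂ) ≠ 0 := by simpa using ha
  have hw0 : (w : ℂ) ≠ 0 := by simpa using hw
  have hmul : Tendsto (fun ρ : K => a * ρ) (𝓝 1) (𝓝 a) := by
    have : Continuous fun ρ : K => a * ρ := by fun_prop
    simpa using this.tendsto 1
  obtain ⟨δ, hδ, hball⟩ := Metric.mem_nhds_iff.mp (hmul hV)
  have hlog : 0 < -Real.log ‖(a : ℂ)‖ :=
    neg_pos.mpr (Real.log_neg (norm_pos_iff.mpr ha0) ha1)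
  have hlim : Tendsto (fun k : ℕ => Real.log ‖(w : ℂ)‖ + k * (-Real.log ‖(a : ℂ)‖)) atTop atTop :=
    tendsto_atTop_add_const_left _ _ (tendsto_natCast_atTop_atTop.atTop_mul_const hlog)
  filter_upwards [hlim.eventually_ge_atTop 1, eventually_ge_atTop 6,
    tendsto_natCast_atTop_atTop.eventually_gt_atTop (12 / δ)] with k hk1 hk6 hkδ
  have hk0 : (0 : ℝ) < k := by exact_mod_cast (by omega : 0 < k)
  have hkC : (k : ℂ) ≠ 0 := by exact_mod_cast hk0.ne'
  have hKinv : ∀ z ∈ K, z⁻¹ ∈ K := by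
    rcases hK with rfl | rfl
    · exact fun _ _ => trivial
    · rintro _ ⟨x, rfl⟩
      exact ⟨x⁻¹, by simp⟩
  set z : ℂ := w * ((a : ℂ) ^ k)⁻¹ with hz
  have hzK : z ∈ K := mul_mem w.2 (hKinv _ (pow_mem a.2 k))
  have hz0 : z ≠ 0 := mul_ne_zero hw0 (inv_ne_zero (pow_ne_zero k ha0))
  obtain ⟨ε, hε, hL⟩ := exists_log_mem_of_eq_top_or_bot hK hzK
  set L := Complex.log ((-1) ^ ε * z) with hLdef
  have hre : L.re = Real.log ‖(w : ℂ)‖ + k * (-Real.log ‖(a : ℂ)‖) := by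
    rw [hLdef, Complex.log_re, hz]
    simp only [norm_mul, norm_pow, norm_inv, norm_neg, norm_one, one_pow, one_mul]
    rw [Real.log_mul (norm_ne_zero_iff.mpr hw0)
      (inv_ne_zero (pow_ne_zero k (norm_ne_zero_iff.mpr ha0))), Real.log_inv, Real.log_pow]
    ring
  obtain ⟨l, hl⟩ := exists_nat_parity_near hε (hre ▸ hk1 : 1 ≤ L.re)
  set m := 2 * l + ε with hm
  have hy : ‖L - m‖ ≤ 6 := by
    refine (Complex.norm_le_abs_re_add_abs_im _).trans ?_
    have h1 : |(L - m).re| ≤ 2 := by simpa using hl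
    have h2 : |(L - m).im| ≤ 4 := by
      have : (L - m).im = Complex.arg ((-1) ^ ε * z) := by simp [hLdef, Complex.log_im]
      rw [this]
      exact (Complex.abs_arg_le_pi _).trans Real.pi_le_four
    linarith
  have hyk : ‖(L - m) / k‖ ≤ 6 / k := by
    rw [norm_div, Complex.norm_natCast]
    gcongr
  have hyK : (L - m) / k ∈ K := by
    rw [div_eq_mul_inv]
    exact mul_mem (sub_mem hL (natCast_mem K m)) (hKinv _ (natCast_mem K k))
  let ρ : K := ⟨Complex.exp ((L - m) / k), exp_mem_of_eq_top_or_bot hK hyK⟩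
  have hρ : dist ρ 1 < δ := by
    rw [Subtype.dist_eq, dist_eq_norm]
    change ‖Complex.exp ((L - m) / k) - 1‖ < δ
    have h1 : ‖(L - m) / k‖ ≤ 1 := hyk.trans (by
      rw [div_le_one hk0]
      exact_mod_cast hk6)
    calc _ ≤ 2 * ‖(L - m) / k‖ := Complex.norm_exp_sub_one_le h1
      _ ≤ 2 * (6 / k) := by gcongr
      _ = 12 / k := by ring
      _ < δ := by rwa [div_lt_comm₀ hk0 hδ]
  refine ⟨a * ρ, hball hρ, m, Subtype.ext ?_⟩
  have hρk : Complex.exp ((L - m) / k) ^ k = (-1) ^ ε * z * (Complex.exp 1 ^ m)⁻¹ := by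
    rw [← Complex.exp_nat_mul, mul_div_cancel₀ _ hkC, Complex.exp_sub, hLdef,
      Complex.exp_log (mul_ne_zero (by simp) hz0), ← Complex.exp_nat_mul, mul_one, div_eq_mul_inv]
  have hsign : (-1 : ℂ) ^ m * (-1) ^ ε = 1 := by
    rw [← pow_add, hm, show 2 * l + ε + ε = 2 * (l + ε) by ring, pow_mul]
    simp
  push_cast
  rw [coe_negExpOne, mul_pow]
  change _ * (_ * Complex.exp ((L - m) / k) ^ k) = _
  rw [hρk, neg_pow, hz]
  have he : Complex.exp 1 ^ m ≠ 0 := pow_ne_zero _ (Complex.exp_ne_zero 1)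
  have hak : (a : ℂ) ^ k ≠ 0 := pow_ne_zero k ha0
  field_simp
  linear_combination hsign

end Block

section Product

variable {r : ℕ} (K : Fin r → Subalgebra ℝ ℂ)

/-- The generators of a hypercyclic semigroup in a product of copies of `ℝ` and `ℂ`: a generic
element together with `-e` in each factor. -/
noncomputable def blockGenerators (a : ∀ j, K j) : Fin (r + 1) → ∀ j, K j :=
  Fin.cons a fun j => Pi.mulSingle j (negExpOne (K j))

/-- Permits zero exponents in a semigroup without identity, once one factor lies in it. -/
theorem mul_mem_of_mem_closure {M : Type*} [Monoid M] {S : Subsemigroup M} {a b : M} (ha : a ∈ S)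
    (hb : b ∈ Submonoid.closure (S : Set M)) : a * b ∈ S := by
  induction hb using Submonoid.closure_induction generalizing a with
  | mem x hx => exact mul_mem ha hx
  | one => simpa using ha
  | mul x y _ _ hx hy =>
    rw [← mul_assoc]
    exact hy (hx ha)

theorem pow_succ_mul_mem_closure (a : ∀ j, K j) (k : ℕ) (m : Fin r → ℕ) :
    (fun j => negExpOne (K j) ^ m j * a j ^ (k + 1)) ∈
      Subsemigroup.closure (Set.range (blockGenerators K a)) := by
  set S := Subsemigroup.closure (Set.range (blockGenerators K a))
  have ha : a ∈ S := Subsemigroup.subset_closure ⟨0, rfl⟩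
  have hμ : ∀ j, Pi.mulSingle j (negExpOne (K j)) ∈ S := fun j =>
    Subsemigroup.subset_closure ⟨j.succ, rfl⟩
  have hb : a ^ k * ∏ j, (Pi.mulSingle j (negExpOne (K j)) : ∀ j, K j) ^ m j ∈
      Submonoid.closure (S : Set (∀ j, K j)) :=
    mul_mem (pow_mem (Submonoid.subset_closure ha) k)
      (prod_mem fun j _ => pow_mem (Submonoid.subset_closure (hμ j)) _)
  convert mul_mem_of_mem_closure ha hb using 1
  simp_rw [← Pi.mulSingle_pow]
  rw [Finset.univ_prod_mulSingle (fun j => negExpOne (K j) ^ m j)]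
  funext j
  simp only [Pi.mul_apply, Pi.pow_apply]
  ring

theorem exists_dense_closure_blockGenerators (hK : ∀ j, K j = ⊤ ∨ K j = ⊥) :
    ∃ a : ∀ j, K j, Dense (Subsemigroup.closure (Set.range (blockGenerators K a)) :
      Set (∀ j, K j)) := by
  have : ∀ j, CompleteSpace (K j) := fun j => FiniteDimensional.complete ℝ (K j)
  have hdense : Dense {x : ∀ j, K j | ∀ j, x j ≠ 0} := by
    have : {x : ∀ j, K j | ∀ j, x j ≠ 0} = Set.univ.pi fun j => ({0}ᶜ : Set (K j)) := by
      ext x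
      simp
    rw [this]
    refine dense_pi _ fun j _ => ?_
    have : NeBot (𝓝[≠] (0 : K j)) := Module.punctured_nhds_neBot ℝ (K j) 0
    exact dense_compl_singleton 0
  let F : ℕ × (Fin r → ℕ) → (∀ j, K j) → ∀ j, K j :=
    fun km x j => negExpOne (K j) ^ km.2 j * x j ^ (km.1 + 1)
  have hF : ∀ i, Continuous (F i) := fun i => by fun_prop
  have hW : IsOpen {x : ∀ j, K j | ∀ j, ‖(x j : ℂ)‖ < 1} := by
    simp only [Set.ofPred_forall]
    exact isOpen_iInter_of_finite fun j => isOpen_lt (by fun_prop) continuous_const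
  obtain ⟨a, -, ha⟩ := exists_dense_range_of_transitive F hF hW ⟨0, fun j => by simp⟩ (by
    intro V hVW hV hVne U hU hUne
    obtain ⟨x, hxV, hx0⟩ := hdense.inter_open_nonempty V hV hVne
    obtain ⟨w, hwU, hw0⟩ := hdense.inter_open_nonempty U hU hUne
    obtain ⟨δ, hδ, hball⟩ := Metric.isOpen_iff.mp hV x hxV
    -- Having all large `k` in each factor gives one exponent common to all.
    have hev := (eventually_all.mpr fun j =>
      eventually_exists_pow_mul_pow_eq (hK j) (hx0 j) (hVW hxV j) (hw0 j)
        (Metric.ball_mem_nhds (x j) hδ)).and (eventually_ge_atTop 1)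
    obtain ⟨k, hk, hk1⟩ := hev.exists
    obtain ⟨k, rfl⟩ := Nat.exists_eq_add_of_le' hk1
    choose y hy m hm using hk
    refine ⟨(k, m), y, hball ?_, ?_⟩
    · rw [Metric.mem_ball, dist_pi_lt_iff hδ]
      exact hy
    · rwa [show F (k, m) y = w from funext hm])
  refine ⟨a, ha.mono ?_⟩
  rintro _ ⟨⟨k, m⟩, rfl⟩
  exact pow_succ_mul_mem_closure K a k m

end Product

/-! ### Transfer to matrices by the regular representation -/

/-- A tuple in a finite-dimensional commutative real algebra that generates a dense multiplicative
semigroup yields a tuple of matrices that generates an abelian hypercyclic semigroup. -/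
theorem exists_isHypercyclic_of_dense {R : Type*} [CommRing R] [Algebra ℝ R] [TopologicalSpace R]
    [IsTopologicalAddGroup R] [ContinuousSMul ℝ R] [T2Space R] [FiniteDimensional ℝ R] {n p : ℕ}
    (hn : finrank ℝ R = n) (g : Fin p → R)
    (hg : Dense (Subsemigroup.closure (Set.range g) : Set R)) :
    ∃ A : Fin p → Matrix (Fin n) (Fin n) ℝ,
      IsAbelian (generatedBy A) ∧ IsHypercyclic (generatedBy A) := by
  let B : Basis (Fin n) ℝ R := finBasisOfFinrankEq ℝ R hn
  let Φ := Algebra.leftMulMatrix B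
  refine ⟨fun i => Φ (g i), ?_, B.equivFun 1, ?_⟩
  · have hΦ : ∀ M ∈ generatedBy fun i => Φ (g i), ∃ x, Φ x = M := by
      intro M hM
      induction hM using Subsemigroup.closure_induction with
      | mem x hx =>
        obtain ⟨i, rfl⟩ := hx
        exact ⟨g i, rfl⟩
      | mul x y _ _ hx hy =>
        obtain ⟨s, rfl⟩ := hx
        obtain ⟨t, rfl⟩ := hy
        exact ⟨s * t, map_mul Φ s t⟩
    intro M hM N hN
    obtain ⟨s, rfl⟩ := hΦ M hM
    obtain ⟨t, rfl⟩ := hΦ N hN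
    rw [← map_mul, ← map_mul, mul_comm]
  · let e : R ≃L[ℝ] (Fin n → ℝ) := B.equivFun.toContinuousLinearEquiv
    refine (e.surjective.denseRange.dense_image e.continuous hg).mono ?_
    rintro _ ⟨x, hx, rfl⟩
    refine ⟨Φ x, ?_, ?_⟩
    · induction hx using Subsemigroup.closure_induction with
      | mem x hx =>
        obtain ⟨i, rfl⟩ := hx
        exact Subsemigroup.subset_closure ⟨i, rfl⟩
      | mul x y _ _ hx hy =>
        rw [map_mul]
        exact mul_mem hx hy
    · have := Algebra.leftMulMatrix_mulVec_repr B x 1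
      rw [mul_one] at this
      exact this

/-- The factors of a product of copies of `ℂ`, and of one copy of `ℝ` if `n` is odd, of
dimension `n`. -/
noncomputable def blocks (n : ℕ) (j : Fin ((n + 1) / 2)) : Subalgebra ℝ ℂ :=
  if 2 * (j : ℕ) + 1 = n then ⊥ else ⊤

theorem finrank_pi_blocks (n : ℕ) : finrank ℝ (∀ j, blocks n j) = n := by
  have h : ∀ j, finrank ℝ (blocks n j) = if 2 * (j : ℕ) + 1 = n then 1 else 2 := by
    intro j
    split_ifs with hj
    · rw [show blocks n j = ⊥ from if_pos hj, Subalgebra.finrank_bot]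
    · rw [show blocks n j = ⊤ from if_neg hj, subalgebra_top_finrank_eq_submodule_top_finrank,
        finrank_top, Complex.finrank_real_complex]
  rw [finrank_pi_fintype]
  simp_rw [h]
  rw [Fin.sum_univ_eq_sum_range (fun j => if 2 * j + 1 = n then 1 else 2)]
  obtain ⟨m, rfl | rfl⟩ := Nat.even_or_odd' n
  · rw [Finset.sum_congr rfl (g := fun _ => 2) fun j _ => if_neg (by omega)]
    simp
    omega
  · rw [show (2 * m + 1 + 1) / 2 = m + 1 by omega, Finset.sum_range_succ,
      Finset.sum_congr rfl (g := fun _ => 2) fun j hj =>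
        if_neg (by have := Finset.mem_range.mp hj; omega)]
    simp
    omega

theorem exists_isAbelian_isHypercyclic (n : ℕ) :
    ∃ A : Fin ((n + 1) / 2 + 1) → Matrix (Fin n) (Fin n) ℝ,
      IsAbelian (generatedBy A) ∧ IsHypercyclic (generatedBy A) := by
  obtain ⟨a, ha⟩ := exists_dense_closure_blockGenerators (blocks n) fun j => by
    unfold blocks
    split_ifs
    · exact Or.inr rfl
    · exact Or.inl rfl
  exact exists_isHypercyclic_of_dense (finrank_pi_blocks n) _ ha

end MatrixSemigroup

theorem corollary1p9 (n : ℕ) (hn : 1 ≤ n) :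
    IsLeast
      {p : ℕ | ∃ A : Fin p → Matrix (Fin n) (Fin n) ℝ,
        MatrixSemigroup.IsAbelian (MatrixSemigroup.generatedBy A) ∧
        MatrixSemigroup.IsHypercyclic (MatrixSemigroup.generatedBy A)}
      ((n + 1) / 2 + 1) := by
  refine ⟨MatrixSemigroup.exists_isAbelian_isHypercyclic n, ?_⟩
  rintro p ⟨A, hab, hhc⟩
  have := MatrixSemigroup.add_two_le_of_isHypercyclic hn A hab hhc
  omega
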